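/- An index is a tuple of positive integers $(k_1,\dots,k_r)$ with $r\ge 1$. For an index with $k_1\ge 2$, let $$\zeta(k_1,\dots,k_r)=\sum_{n_1>\cdots>n_r\ge 1}\frac{1}{n_1^{k_1}\cdots n_r^{k_r}}$$ be the multiple zeta value. Hoffman's dual index of an index $\mathbf{k}=(k_1,\dots,k_r)$ is $$\mathbf{k}^{\vee}=(\underbrace{1,\dots,1}_{k_1}+\underbrace{1,\dots,1}_{k_2}+1,\dots,1+\underbrace{1,\dots,1}_{k_r}),$$ that is, one writes each $k_i$ as a sum $1+\cdots+1$ of $k_i$ ones and then interchanges all commas and plus signs. Theorem (Ohno type relation for multiple zeta values). For every $r\ge 1$, every $(k_1,\dots,k_r)\in\mathbb{Z}_{\ge 1}^r$ and every $m\in\mathbb{Z}_{\ge 0}$, $$\sum_{\substack{e_1+\cdots+e_r=m\\ e_i\ge 0\ (1\le i\le r)}}\zeta(k_1+e_1+1,k_2+e_2,\dots,k_r+e_r)=\sum_{\substack{e'_1+\cdots+e'_{r'}=m\\ e'_i\ge 0\ (1\le i\le r')}}\zeta\bigl((1,k'_1+e'_1,\dots,k'_{r'}+e'_{r'})^{\vee}\bigr),$$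 where $(k'_1,\dots,k'_{r'})=(k_1,\dots,k_r)^{\vee}$ is Hoffman's dual index of $(k_1,\dots,k_r)$. -/

import Mathlib

/-- The multiple zeta value `ζ(k₁, …, kᵣ) = ∑_{n₁ > ⋯ > nᵣ ≥ 1} 1 / (n₁^{k₁} ⋯ nᵣ^{kᵣ})`.
The series converges whenever all `kᵢ ≥ 1` and `k₁ ≥ 2`. -/
noncomputable def mzv (k : List ℕ) : ℝ :=
  ∑' n : {n : Fin k.length → ℕ // StrictAnti n ∧ ∀ i, 1 ≤ n i},
    ∏ i, 1 / (n.1 i : ℝ) ^ k.get i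

theorem summable_prod_tuple (g : ℕ → ℝ) (hg : Summable g) (h0 : ∀ n, 0 ≤ g n) (r : ℕ) :
    Summable (fun n : Fin r → ℕ => ∏ i, g (n i)) := by
  induction r with
  | zero => exact Summable.of_finite
  | succ r ih =>
    rw [← (Fin.consEquiv (fun _ : Fin (r+1) => ℕ)).summable_iff]
    have := hg.mul_of_nonneg ih h0 (fun n => Finset.prod_nonneg fun i _ => h0 _)
    refine this.congr fun x => ?_
    simp [Fin.prod_univ_succ, Fin.consEquiv]

/-- The series defining `mzv k` converges for every admissible index `k`. -/
theorem mzv_summable (k : List ℕ) (hpos : ∀ a ∈ k, 1 ≤ a) (h2 : ∀ a ∈ k.head?, 2 ≤ a) :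
    Summable fun n : {n : Fin k.length → ℕ // StrictAnti n ∧ ∀ i, 1 ≤ n i} =>
      ∏ i, 1 / (n.1 i : ℝ) ^ k.get i := by
  rcases k with _ | ⟨a, l⟩
  · have : Finite (Fin ([] : List ℕ).length → ℕ) := inferInstanceAs (Finite (Fin 0 → ℕ))
    exact Summable.of_finite
  have ha : 2 ≤ a := h2 a (by simp)
  set r : ℝ := (l.length + 1 : ℝ) with hr
  have hr0 : 0 < r := by positivity
  have hs := summable_prod_tuple (fun n : ℕ => 1 / (n : ℝ) ^ (1 + 1 / r))
    (Real.summable_one_div_nat_rpow.2 (by simp [hr0])) (fun n => by positivity) (a :: l).length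
  refine Summable.of_nonneg_of_le (fun n => by positivity) (fun n => ?_)
    (hs.comp_injective Subtype.val_injective)
  obtain ⟨n, hn, h1⟩ := n
  have h1' : ∀ i, (1 : ℝ) ≤ n i := fun i => by exact_mod_cast h1 i
  have hp : ∀ i, (0 : ℝ) < n i := fun i => by linarith [h1' i]
  simp only [Function.comp, one_div, Finset.prod_inv_distrib]
  apply inv_anti₀ (Finset.prod_pos fun i _ => Real.rpow_pos_of_pos (hp i) _)
  simp only [Real.rpow_add (hp _), Real.rpow_one, Finset.prod_mul_distrib]
  have hA : ∏ i, (n i : ℝ) ^ r⁻¹ ≤ n ⟨0, by simp⟩ := by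
    calc ∏ i, (n i : ℝ) ^ r⁻¹ ≤ ∏ i : Fin (a :: l).length, (n ⟨0, by simp⟩ : ℝ) ^ r⁻¹ := by
          refine Finset.prod_le_prod (fun i _ => by positivity) fun i _ => ?_
          refine Real.rpow_le_rpow (hp i).le ?_ (by positivity)
          exact_mod_cast hn.antitone (Fin.mk_le_of_le_val (Nat.zero_le _))
      _ = n ⟨0, by simp⟩ := by
          rw [Finset.prod_const, Finset.card_univ, Fintype.card_fin, ← Real.rpow_natCast,
            ← Real.rpow_mul (hp _).le]
          have : r⁻¹ * ((a :: l).length : ℝ) = 1 := by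
            rw [List.length_cons]; push_cast; exact inv_mul_cancel₀ hr0.ne'
          rw [this, Real.rpow_one]
  refine (mul_le_mul_of_nonneg_left hA (Finset.prod_nonneg fun i _ => (hp i).le)).trans ?_
  change (∏ i : Fin (l.length + 1), (n i : ℝ)) * n 0 ≤
    ∏ i : Fin (l.length + 1), (n i : ℝ) ^ (a :: l).get i
  rw [Fin.prod_univ_succ, Fin.prod_univ_succ, mul_right_comm]
  refine mul_le_mul ?_ ?_ (Finset.prod_nonneg fun i _ => (hp _).le) (by positivity)
  · rw [← sq]; exact pow_le_pow_right₀ (h1' _) ha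
  · refine Finset.prod_le_prod (fun i _ => (hp _).le) fun i _ => ?_
    exact le_self_pow₀ (h1' _) (by have := hpos ((a :: l).get i.succ) (List.get_mem _ _); omega)

/-- `(a₁, …, a_p) + (b₁, …, b_q) = (a₁, …, a_{p-1}, a_p + b₁, b₂, …, b_q)`: join two lists,
putting a plus instead of a comma between the last entry of the first list and the first entry of
the second one. -/
def plusJoin : List ℕ → List ℕ → List ℕ
  | [], l => l
  | [a], [] => [a]
  | [a], b :: l => (a + b) :: l
  | a :: a' :: l, l' => a :: plusJoin (a' :: l) l'

/-- Hoffman's dual index: `(1, …, 1 + 1, …, 1 + ⋯ + 1, …, 1)`, with `k₁` ones in the first block,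
`k₂` ones in the second block, and so on, consecutive blocks being joined by a plus. -/
def hoffmanDual : List ℕ → List ℕ
  | [] => []
  | a :: l => plusJoin (List.replicate a 1) (hoffmanDual l)

/-- `(k₁ + e₁, …, kᵣ + eᵣ)`. -/
def addTuple (k : List ℕ) (e : Fin k.length → ℕ) : List ℕ :=
  List.ofFn fun i => k.get i + e i

/-! Encode an index by its word `x^{k₁-1} y ⋯ x^{kᵣ-1} y`. Raising the first entry prepends an `x`,
and Hoffman's dual swaps the letters before the final `y` without changing their order
(`indexWord_hoffmanDual`). Classical duality swaps and reverses the letters between a leading `x`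
and the final `y`, so it matches `k` with first entry raised to the reversed Hoffman dual with first
entry raised.

The sums over shifts `e` with total `N` are the coefficients of `x ^ N` in a single deformed nested
sum, because `1 / ((n - x) n^{a-1})` is the geometric series `∑ x^i / n^{a+i}` (`tsum_indexSum`).
Duality holds for the deformed sums at every `0 ≤ x < 1` (`tsum_wordSum_dual`), by the connected
sums of Seki and Yamamoto. Comparing coefficients gives Ohno's relation. The case `x = 0` rewrites
each term on the right of the theorem as the value at a reversed, raised index
(`mzv_hoffmanDual_one_cons`), which turns that side into the dual Ohno sum.

Working in `ℝ≥0∞` makes every interchange of sums free; finiteness matters only when coefficients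
are compared and when real zeta values are recovered. -/

open scoped ENNReal

/-! ### Deformed nested sums and the connector -/

/-- The nested sum attached to a word in two letters, with largest summation variable `m`. The
letter `true` divides by the current variable `m`, the letter `false` introduces a new largest
variable `m` with weight `1 / (m - x)`. -/
noncomputable def wordSum (x : ℝ) : List Bool → ℕ → ℝ≥0∞
  | [], m => if m = 0 then 1 else 0
  | true :: w, m => ENNReal.ofReal (1 / m) * wordSum x w m
  | false :: w, m => ENNReal.ofReal (1 / (m - x)) * ∑ n ∈ Finset.range m, wordSum x w n

/-- The product `(1 - x) (2 - x) ⋯ (n - x)`. -/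
noncomputable def shiftedFactorial (x : ℝ) (n : ℕ) : ℝ := ∏ i ∈ Finset.range n, ((i : ℝ) + 1 - x)

/-- The connector of Seki and Yamamoto. -/
noncomputable def connector (x : ℝ) (m n : ℕ) : ℝ :=
  shiftedFactorial x m * shiftedFactorial x n / shiftedFactorial x (m + n)

theorem shiftedFactorial_pos {x : ℝ} (hx : x < 1) (n : ℕ) : 0 < shiftedFactorial x n :=
  Finset.prod_pos fun i _ => by have : (0 : ℝ) ≤ i := i.cast_nonneg; linarith

theorem shiftedFactorial_succ (x : ℝ) (n : ℕ) :
    shiftedFactorial x (n + 1) = shiftedFactorial x n * (n + 1 - x) :=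
  Finset.prod_range_succ _ _

theorem connector_comm (x : ℝ) (m n : ℕ) : connector x m n = connector x n m := by
  simp only [connector, add_comm m n, mul_comm]

theorem connector_zero_right {x : ℝ} (hx : x < 1) (m : ℕ) : connector x m 0 = 1 := by
  have h0 : shiftedFactorial x 0 = 1 := Finset.prod_range_zero _
  rw [connector, h0, mul_one, add_zero, div_self (shiftedFactorial_pos hx m).ne']

theorem connector_nonneg {x : ℝ} (hx : x < 1) (m n : ℕ) : 0 ≤ connector x m n := by
  have := shiftedFactorial_pos hx
  exact div_nonneg (mul_nonneg (this _).le (this _).le) (this _).le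

/-- Passing from `n` to `n + 1` multiplies the connector by `(n + 1 - x) / (m + n + 1 - x)`, which
differs from `1` by `m / (m + n + 1 - x)`. This is the telescoping identity behind the transport
relation. -/
theorem connector_sub_connector_succ {x : ℝ} (hx : x < 1) (m n : ℕ) :
    connector x m n - connector x m (n + 1) =
      m * (1 / ((n + 1 : ℕ) - x) * connector x m (n + 1)) := by
  have hp := fun k => (shiftedFactorial_pos hx k).ne'
  have h1 : (n : ℝ) + 1 - x ≠ 0 := by have : (0 : ℝ) ≤ n := n.cast_nonneg; linarith
  have h2 : (m : ℝ) + n + 1 - x ≠ 0 := by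
    have : (0 : ℝ) ≤ n := n.cast_nonneg
    have : (0 : ℝ) ≤ m := m.cast_nonneg
    linarith
  have h3 := hp (m + n)
  rw [connector, connector, ← add_assoc, shiftedFactorial_succ, shiftedFactorial_succ]
  push_cast
  field_simp
  ring

/-- The connector decreases in its first argument, and for first argument `1` it equals `(1 - x) /
(n + 1 - x)`. The bound supplies the vanishing limit at infinity in the telescoping sum. -/
theorem connector_succ_le {x : ℝ} (hx0 : 0 ≤ x) (hx : x < 1) (m n : ℕ) :
    connector x (m + 1) n ≤ 1 / ((n : ℝ) + 1 - x) := by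
  have hn : (0 : ℝ) ≤ n := n.cast_nonneg
  induction m with
  | zero =>
    have hp := shiftedFactorial_pos hx n
    have : (0 : ℝ) < n + 1 - x := by linarith
    have h1 : shiftedFactorial x 1 = 1 - x := by simp [shiftedFactorial]
    rw [connector, zero_add, h1, add_comm 1 n, shiftedFactorial_succ,
      div_le_div_iff₀ (by positivity) this]
    nlinarith [mul_pos hp this]
  | succ m ih =>
    have h := connector_sub_connector_succ hx n (m + 1)
    rw [connector_comm x n, connector_comm x n] at h
    have h0 : (0 : ℝ) ≤ n * (1 / (((m + 1 + 1 : ℕ) : ℝ) - x) * connector x (m + 1 + 1) n) := by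
      refine mul_nonneg hn (mul_nonneg ?_ (connector_nonneg hx _ _))
      have : (0 : ℝ) ≤ m := m.cast_nonneg
      push_cast
      exact one_div_nonneg.2 (by linarith)
    linarith

theorem tendsto_connector {x : ℝ} (hx0 : 0 ≤ x) (hx : x < 1) {m : ℕ} (hm : m ≠ 0) :
    Filter.Tendsto (connector x m) Filter.atTop (nhds 0) := by
  obtain ⟨m, rfl⟩ := Nat.exists_eq_succ_of_ne_zero hm
  refine squeeze_zero (fun n => connector_nonneg hx _ _) (connector_succ_le hx0 hx m) ?_
  simp only [one_div, add_sub_assoc]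
  exact (Filter.tendsto_atTop_add_const_right _ _ tendsto_natCast_atTop_atTop).inv_tendsto_atTop

/-- Telescoping sum over the second variable of the connector. -/
theorem tsum_connector {x : ℝ} (hx0 : 0 ≤ x) (hx : x < 1) {m : ℕ} (hm : m ≠ 0) (n : ℕ) :
    (∑' a : ℕ, if n < a then
        ENNReal.ofReal (1 / (a - x)) * ENNReal.ofReal (connector x m a) else 0) =
      ENNReal.ofReal (1 / m) * ENNReal.ofReal (connector x m n) := by
  have hm' : (m : ℝ) ≠ 0 := by exact_mod_cast hm
  have hpos : ∀ i : ℕ, 0 ≤ 1 / (((i + n + 1 : ℕ) : ℝ) - x) := fun i => by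
    have : (0 : ℝ) ≤ (i + n : ℕ) := Nat.cast_nonneg _
    push_cast at *
    exact one_div_nonneg.2 (by linarith)
  have hs : HasSum (fun i : ℕ => 1 / (((i + n + 1 : ℕ) : ℝ) - x) * connector x m (i + n + 1))
      (1 / m * connector x m n) := by
    rw [hasSum_iff_tendsto_nat_of_nonneg
      (fun i => mul_nonneg (hpos i) (connector_nonneg hx _ _))]
    have : ∀ N, ∑ i ∈ Finset.range N,
        1 / (((i + n + 1 : ℕ) : ℝ) - x) * connector x m (i + n + 1) =
        1 / m * (connector x m n - connector x m (N + n)) := by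
      intro N
      have h := Finset.sum_range_sub' (fun i => connector x m (i + n)) N
      simp only [zero_add] at h
      rw [← h, Finset.mul_sum]
      refine Finset.sum_congr rfl fun i _ => ?_
      rw [add_right_comm i 1 n, connector_sub_connector_succ hx]
      field_simp
    simp only [this]
    have := ((tendsto_connector hx0 hx hm).comp (Filter.tendsto_add_atTop_nat n)).const_sub
      (connector x m n)
    simpa [Function.comp_def] using this.const_mul (1 / (m : ℝ))
  rw [← ENNReal.ofReal_mul (by positivity), ← hs.tsum_eq, ENNReal.ofReal_tsum_of_nonneg
    (fun i => mul_nonneg (hpos i) (connector_nonneg hx _ _)) hs.summable,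
    ← (ENNReal.summable).sum_add_tsum_nat_add' (k := n + 1), Finset.sum_eq_zero, zero_add]
  · refine tsum_congr fun i => ?_
    rw [if_pos (by omega), ← add_assoc, ENNReal.ofReal_mul (hpos i)]
  · intro i hi
    rw [if_neg]
    have := Finset.mem_range.1 hi
    omega

/-! ### Connected sums and duality -/

/-- The connected sum of two words. -/
noncomputable def connectedSum (x : ℝ) (u v : List Bool) : ℝ≥0∞ :=
  ∑' m, ∑' n, wordSum x u m * wordSum x v n * ENNReal.ofReal (connector x m n)

theorem connectedSum_comm (x : ℝ) (u v : List Bool) :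
    connectedSum x u v = connectedSum x v u := by
  rw [connectedSum, connectedSum, ENNReal.tsum_comm]
  simp only [connector_comm x, mul_comm (wordSum x u _)]

/-- This discards the term `m = 0` of a connected sum, where telescoping is unavailable because the
connector is constantly `1`. -/
theorem wordSum_zero_right (x : ℝ) (w : List Bool) : wordSum x (w ++ [false]) 0 = 0 := by
  induction w with
  | nil => simp [wordSum]
  | cons b w ih => cases b <;> simp [wordSum, ih]

theorem tsum_mul_sum_range (φ f : ℕ → ℝ≥0∞) :
    ∑' a, φ a * ∑ n ∈ Finset.range a, f n = ∑' n, f n * ∑' a, if n < a then φ a else 0 := by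
  simp only [← ENNReal.tsum_mul_left]
  rw [ENNReal.tsum_comm]
  refine tsum_congr fun a => ?_
  rw [tsum_eq_sum (s := Finset.range a), Finset.mul_sum]
  · refine Finset.sum_congr rfl fun n hn => ?_
    rw [if_pos (Finset.mem_range.1 hn), mul_comm]
  · intro n hn
    rw [if_neg (by simpa using hn), mul_zero]

/-- The transport relation for connected sums. -/
theorem connectedSum_transport {x : ℝ} (hx0 : 0 ≤ x) (hx : x < 1) (u v : List Bool) :
    connectedSum x (true :: (u ++ [false])) v = connectedSum x (u ++ [false]) (false :: v) := by
  refine tsum_congr fun m => ?_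
  rcases eq_or_ne m 0 with rfl | hm
  · simp [wordSum, wordSum_zero_right]
  have : ∀ n, wordSum x (u ++ [false]) m * wordSum x (false :: v) n *
      ENNReal.ofReal (connector x m n) = wordSum x (u ++ [false]) m *
      (ENNReal.ofReal (1 / (n - x)) * ENNReal.ofReal (connector x m n) *
        ∑ i ∈ Finset.range n, wordSum x v i) := fun n => by
    rw [wordSum]; ring
  simp only [this, ENNReal.tsum_mul_left, tsum_mul_sum_range, tsum_connector hx0 hx hm]
  rw [← ENNReal.tsum_mul_left]
  refine tsum_congr fun n => ?_
  rw [wordSum]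
  ring

theorem connectedSum_nil {x : ℝ} (hx : x < 1) (u : List Bool) :
    connectedSum x u [] = ∑' m, wordSum x u m := by
  refine tsum_congr fun m => ?_
  rw [tsum_eq_single 0]
  · simp [wordSum, connector_zero_right hx]
  · intro n hn
    simp [wordSum, hn]

/-- Transport moves the first letter of the left word to the front of the right word and flips it;
by symmetry of the connector this works for `false` as well as `true`. Moving letters one by one
reverses their order. -/
theorem connectedSum_reverse {x : ℝ} (hx0 : 0 ≤ x) (hx : x < 1) (u v : List Bool) :
    connectedSum x (u ++ [false]) (v ++ [false]) =
      connectedSum x [false] ((u.map (!·)).reverse ++ v ++ [false]) := by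
  induction u generalizing v with
  | nil => rfl
  | cons b u ih =>
    cases b
    · have := ih (true :: v)
      simp only [List.cons_append, List.map_cons, List.reverse_cons, List.append_assoc,
        List.nil_append, Bool.not_false] at this ⊢
      rw [← this, connectedSum_comm, ← connectedSum_transport hx0 hx, connectedSum_comm]
    · have := ih (false :: v)
      simp only [List.cons_append, List.map_cons, List.reverse_cons, List.append_assoc,
        List.nil_append, Bool.not_true] at this ⊢
      rw [← this, connectedSum_transport hx0 hx]

/-- Duality for the deformed nested sums. -/
theorem tsum_wordSum_dual {x : ℝ} (hx0 : 0 ≤ x) (hx : x < 1) (w : List Bool) :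
    ∑' m, wordSum x (true :: (w ++ [false])) m =
      ∑' m, wordSum x (true :: ((w.map (!·)).reverse ++ [false])) m := by
  -- The empty right word adds nothing, since the connector is `1` at `n = 0`. Transporting the
  -- leading `true` gives the right word its final `false`; the last step undoes this with the roles
  -- of the words exchanged.
  rw [← connectedSum_nil hx, ← connectedSum_nil hx, connectedSum_transport hx0 hx]
  have := connectedSum_reverse hx0 hx w []
  simp only [List.nil_append, List.append_nil] at this
  rw [this, connectedSum_comm, ← connectedSum_transport hx0 hx]

/-! ### Words of indices and Hoffman's dual -/

/-- The word `x^{k₁-1} y ⋯ x^{kᵣ-1} y` of an index, with `true` for `x` and `false` for `y`. -/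
def indexWord : List ℕ → List Bool
  | [] => []
  | a :: l => List.replicate (a - 1) true ++ false :: indexWord l

theorem indexWord_append (l l' : List ℕ) : indexWord (l ++ l') = indexWord l ++ indexWord l' := by
  induction l with
  | nil => rfl
  | cons a l ih => simp [indexWord, ih]

theorem indexWord_modifyHead {l : List ℕ} (hne : l ≠ []) (hpos : ∀ a ∈ l, 1 ≤ a) :
    indexWord (l.modifyHead (· + 1)) = true :: indexWord l := by
  obtain ⟨a, l, rfl⟩ := List.exists_cons_of_ne_nil hne
  obtain ⟨a, rfl⟩ := Nat.exists_eq_add_of_le' (hpos a (by simp))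
  simp [indexWord, List.replicate_succ]

/-- The word of a nonempty index ends in `y`, and the word of the reversed index is obtained by
reversing the rest. -/
theorem exists_indexWord_reverse {l : List ℕ} (hne : l ≠ []) :
    ∃ w, indexWord l = w ++ [false] ∧ indexWord l.reverse = w.reverse ++ [false] := by
  induction l with
  | nil => exact absurd rfl hne
  | cons a l ih =>
    rcases eq_or_ne l [] with rfl | hl
    · exact ⟨List.replicate (a - 1) true, by simp [indexWord]⟩
    · obtain ⟨w, h, h'⟩ := ih hl
      exact ⟨List.replicate (a - 1) true ++ false :: w,
        by simp [indexWord, h], by simp [indexWord_append, h', indexWord]⟩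

theorem plusJoin_replicate_succ_nil (a : ℕ) :
    plusJoin (List.replicate (a + 1) 1) [] = List.replicate (a + 1) 1 := by
  induction a with
  | zero => rfl
  | succ a ih => rw [List.replicate_succ, List.replicate_succ, plusJoin, ← List.replicate_succ, ih]

theorem plusJoin_replicate_succ_cons (a b : ℕ) (l : List ℕ) :
    plusJoin (List.replicate (a + 1) 1) (b :: l) = List.replicate a 1 ++ (1 + b) :: l := by
  induction a with
  | zero => rfl
  | succ a ih => rw [List.replicate_succ, List.replicate_succ, plusJoin, ← List.replicate_succ, ih]; rfl

theorem indexWord_replicate_one (a : ℕ) :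
    indexWord (List.replicate a 1) = List.replicate a false := by
  induction a with
  | zero => rfl
  | succ a ih => simp [List.replicate_succ, indexWord, ih]

theorem hoffmanDual_ne_nil {k : List ℕ} (hne : k ≠ []) (hpos : ∀ a ∈ k, 1 ≤ a) :
    hoffmanDual k ≠ [] := by
  obtain ⟨a, l, rfl⟩ := List.exists_cons_of_ne_nil hne
  obtain ⟨a, rfl⟩ := Nat.exists_eq_add_of_le' (hpos a (by simp))
  rw [hoffmanDual]
  rcases hoffmanDual l with _ | ⟨b, t⟩
  · simp [plusJoin_replicate_succ_nil]
  · simp [plusJoin_replicate_succ_cons]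

theorem hoffmanDual_pos {k : List ℕ} (hpos : ∀ a ∈ k, 1 ≤ a) : ∀ a ∈ hoffmanDual k, 1 ≤ a := by
  induction k with
  | nil => simp [hoffmanDual]
  | cons a l ih =>
    obtain ⟨a, rfl⟩ := Nat.exists_eq_add_of_le' (hpos a (by simp))
    have ih := ih fun b hb => hpos b (by simp [hb])
    rw [hoffmanDual]
    rcases h : hoffmanDual l with _ | ⟨b, t⟩
    · rw [plusJoin_replicate_succ_nil]
      exact fun c hc => (List.eq_of_mem_replicate hc).ge
    · rw [plusJoin_replicate_succ_cons]
      rw [h] at ih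
      intro c hc
      simp only [List.mem_append, List.mem_replicate, List.mem_cons] at hc
      rcases hc with hc | hc | hc
      · exact hc.2.ge
      · omega
      · exact ih c (by simp [hc])

/-- Hoffman's dual interchanges the two letters, except for the last one. -/
theorem indexWord_hoffmanDual {k : List ℕ} (hne : k ≠ []) (hpos : ∀ a ∈ k, 1 ≤ a) {w : List Bool}
    (hw : indexWord k = w ++ [false]) : indexWord (hoffmanDual k) = w.map (!·) ++ [false] := by
  induction k generalizing w with
  | nil => exact absurd rfl hne
  | cons a l ih =>
    obtain ⟨a, rfl⟩ := Nat.exists_eq_add_of_le' (hpos a (by simp))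
    have hl := fun b hb => hpos b (List.mem_cons_of_mem _ hb)
    rw [hoffmanDual]
    rcases eq_or_ne l [] with rfl | hne'
    · have : w = List.replicate a true := by
        simpa [indexWord] using hw.symm
      rw [hoffmanDual, plusJoin_replicate_succ_nil, indexWord_replicate_one, this,
        List.replicate_succ']
      simp
    · obtain ⟨v, hv, -⟩ := exists_indexWord_reverse hne'
      have : w = List.replicate a true ++ false :: v := by
        rw [indexWord, hv, ← List.cons_append, ← List.append_assoc] at hw
        simpa using (List.append_cancel_right hw).symm
      obtain ⟨b, t, hbt⟩ := List.exists_cons_of_ne_nil (hoffmanDual_ne_nil hne' hl)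
      have ih := ih hne' hl hv
      rw [hbt] at ih ⊢
      have h2 := indexWord_modifyHead (l := b :: t) (by simp) (hbt ▸ hoffmanDual_pos hl)
      rw [plusJoin_replicate_succ_cons, indexWord_append, indexWord_replicate_one, add_comm 1 b]
      simp only [List.modifyHead_cons] at h2
      rw [h2, ih, this]
      simp

/-! ### Sums over shifted indices and their generating function -/

/-- Nested sums attached to an index, with largest summation variable `m`. -/
noncomputable def indexSum (x : ℝ) : List ℕ → ℕ → ℝ≥0∞
  | [], m => if m = 0 then 1 else 0
  | a :: l, m => ENNReal.ofReal (1 / ((m - x) * m ^ (a - 1))) *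
      ∑ n ∈ Finset.range m, indexSum x l n

theorem wordSum_replicate_true (x : ℝ) (a : ℕ) (w : List Bool) (m : ℕ) :
    wordSum x (List.replicate a true ++ w) m =
      ENNReal.ofReal (1 / m ^ a) * wordSum x w m := by
  induction a with
  | zero => simp
  | succ a ih =>
    rw [List.replicate_succ, List.cons_append, wordSum, ih, ← mul_assoc,
      ← ENNReal.ofReal_mul (by positivity), pow_succ']
    congr 2
    field_simp

theorem wordSum_indexWord {x : ℝ} (k : List ℕ) : wordSum x (indexWord k) = indexSum x k := by
  induction k with
  | nil => rfl
  | cons a l ih =>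
    funext m
    rw [indexWord, wordSum_replicate_true, wordSum, indexSum, ih, ← mul_assoc,
      ← ENNReal.ofReal_mul (by positivity)]
    congr 2
    rw [one_div_mul_one_div, mul_comm]

/-- The sum of `Φ (k + e)` over all tuples `e` of natural numbers with sum `m`. -/
def shiftSum {M : Type*} [AddCommMonoid M] : List ℕ → ℕ → (List ℕ → M) → M
  | [], m, Φ => if m = 0 then Φ [] else 0
  | a :: l, m, Φ => ∑ p ∈ Finset.HasAntidiagonal.antidiagonal m,
      shiftSum l p.2 fun t => Φ ((a + p.1) :: t)

theorem sum_antidiagonalTuple_succ {M : Type*} [AddCommMonoid M] (r m : ℕ)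
    (f : (Fin (r + 1) → ℕ) → M) :
    ∑ e ∈ Finset.Nat.antidiagonalTuple (r + 1) m, f e =
      ∑ p ∈ Finset.HasAntidiagonal.antidiagonal m, ∑ e ∈ Finset.Nat.antidiagonalTuple r p.2,
        f (Fin.cons p.1 e) := by
  rw [Finset.sum_sigma']
  refine Finset.sum_bij' (fun e _ => ⟨(e 0, ∑ i, Fin.tail e i), Fin.tail e⟩)
    (fun s _ => Fin.cons s.1.1 s.2) ?_ ?_ ?_ ?_ ?_
  · intro e he
    simp only [Finset.Nat.mem_antidiagonalTuple, Fin.sum_univ_succ] at he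
    simp [Finset.Nat.mem_antidiagonalTuple, ← he, Fin.tail]
  · rintro ⟨⟨i, j⟩, e⟩ hs
    simp only [Finset.mem_sigma, Finset.HasAntidiagonal.mem_antidiagonal,
      Finset.Nat.mem_antidiagonalTuple] at hs
    simp [Finset.Nat.mem_antidiagonalTuple, Fin.sum_univ_succ, hs.1, hs.2]
  · intro e _
    simp
  · rintro ⟨⟨i, j⟩, e⟩ hs
    simp only [Finset.mem_sigma, Finset.HasAntidiagonal.mem_antidiagonal,
      Finset.Nat.mem_antidiagonalTuple] at hs
    simp [hs.2]
  · intro e _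
    simp

theorem sum_addTuple {M : Type*} [AddCommMonoid M] (k : List ℕ) (m : ℕ) (Φ : List ℕ → M) :
    ∑ e ∈ Finset.Nat.antidiagonalTuple k.length m, Φ (addTuple k e) = shiftSum k m Φ := by
  induction k generalizing m Φ with
  | nil => cases m <;> simp [shiftSum, addTuple]
  | cons a l ih =>
    rw [shiftSum]
    refine (sum_antidiagonalTuple_succ l.length m fun e => Φ (addTuple (a :: l) e)).trans ?_
    refine Finset.sum_congr rfl fun p _ => ?_
    rw [← ih]
    refine Finset.sum_congr rfl fun e _ => ?_
    simp [addTuple, List.ofFn_succ]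

theorem shiftSum_congr {M : Type*} [AddCommMonoid M] {k : List ℕ} (hpos : ∀ a ∈ k, 1 ≤ a) (m : ℕ)
    {Φ Ψ : List ℕ → M}
    (h : ∀ l : List ℕ, l.length = k.length → (∀ a ∈ l, 1 ≤ a) → Φ l = Ψ l) :
    shiftSum k m Φ = shiftSum k m Ψ := by
  induction k generalizing m Φ Ψ with
  | nil => simp [shiftSum, h]
  | cons a l ih =>
    refine Finset.sum_congr rfl fun p _ => ih (fun b hb => hpos b (by simp [hb])) _ ?_
    intro t ht htp
    refine h _ (by simp [ht]) ?_
    have := hpos a (by simp)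
    simp only [List.mem_cons, forall_eq_or_imp]
    exact ⟨by omega, htp⟩

theorem shiftSum_modifyHead {M : Type*} [AddCommMonoid M] {k : List ℕ} (hne : k ≠ []) (m : ℕ)
    (Φ : List ℕ → M) :
    shiftSum k m (fun t => Φ (t.modifyHead (· + 1))) = shiftSum (k.modifyHead (· + 1)) m Φ := by
  obtain ⟨a, l, rfl⟩ := List.exists_cons_of_ne_nil hne
  simp [shiftSum, add_right_comm]

theorem shiftSum_sum {M ι : Type*} [AddCommMonoid M] (s : Finset ι) (k : List ℕ) (m : ℕ)
    (Φ : ι → List ℕ → M) :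
    shiftSum k m (fun t => ∑ i ∈ s, Φ i t) = ∑ i ∈ s, shiftSum k m (Φ i) := by
  induction k generalizing m Φ with
  | nil => by_cases h : m = 0 <;> simp [shiftSum, h]
  | cons a l ih =>
    simp only [shiftSum]
    rw [Finset.sum_comm]
    exact Finset.sum_congr rfl fun p _ => ih _ _

theorem shiftSum_concat {M : Type*} [AddCommMonoid M] (l : List ℕ) (a m : ℕ) (Φ : List ℕ → M) :
    shiftSum (l ++ [a]) m Φ =
      ∑ p ∈ Finset.HasAntidiagonal.antidiagonal m, shiftSum l p.2 fun t => Φ (t ++ [a + p.1]) := by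
  induction l generalizing m Φ with
  | nil => simp [shiftSum]
  | cons b l ih =>
    simp only [List.cons_append, shiftSum, ih]
    rw [Finset.sum_sigma', Finset.sum_sigma']
    refine Finset.sum_bij' (fun s _ => ⟨(s.2.1, s.1.1 + s.2.2), (s.1.1, s.2.2)⟩)
      (fun s _ => ⟨(s.2.1, s.1.1 + s.2.2), (s.1.1, s.2.2)⟩) ?_ ?_ ?_ ?_ ?_ <;>
    rintro ⟨⟨i, j⟩, ⟨i', j'⟩⟩ hs <;>
    simp only [Finset.mem_sigma, Finset.HasAntidiagonal.mem_antidiagonal] at hs <;>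
    obtain ⟨rfl, rfl⟩ := hs <;>
    simp [add_left_comm]

theorem shiftSum_reverse {M : Type*} [AddCommMonoid M] (k : List ℕ) (m : ℕ) (Φ : List ℕ → M) :
    shiftSum k m (fun t => Φ t.reverse) = shiftSum k.reverse m Φ := by
  induction k generalizing m Φ with
  | nil => rfl
  | cons a l ih =>
    rw [List.reverse_cons, shiftSum_concat, shiftSum]
    refine Finset.sum_congr rfl fun p _ => ?_
    rw [← ih]
    simp

theorem shiftSum_mul_left (c : ℝ≥0∞) (k : List ℕ) (m : ℕ) (Φ : List ℕ → ℝ≥0∞) :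
    shiftSum k m (fun t => c * Φ t) = c * shiftSum k m Φ := by
  induction k generalizing m Φ with
  | nil => by_cases h : m = 0 <;> simp [shiftSum, h]
  | cons a l ih => simp only [shiftSum, ih, Finset.mul_sum]

theorem tsum_shiftSum (k : List ℕ) (m : ℕ) (Φ : ℕ → List ℕ → ℝ≥0∞) :
    ∑' n, shiftSum k m (Φ n) = shiftSum k m (fun t => ∑' n, Φ n t) := by
  induction k generalizing m Φ with
  | nil => by_cases h : m = 0 <;> simp [shiftSum, h]
  | cons a l ih =>
    simp only [shiftSum]
    rw [Summable.tsum_finsetSum fun _ _ => ENNReal.summable]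
    exact Finset.sum_congr rfl fun p _ => ih _ _

theorem ENNReal.tsum_mul_tsum_eq_tsum_sum_antidiagonal (f g : ℕ → ℝ≥0∞) :
    (∑' i, f i) * ∑' j, g j = ∑' m, ∑ p ∈ Finset.HasAntidiagonal.antidiagonal m, f p.1 * g p.2 := by
  have h : (∑' i, f i) * ∑' j, g j = ∑' p : ℕ × ℕ, f p.1 * g p.2 := by
    rw [ENNReal.tsum_prod (f := fun i j => f i * g j)]
    simp only [ENNReal.tsum_mul_left, ENNReal.tsum_mul_right]
  rw [h, ← Finset.HasAntidiagonal.sigmaAntidiagonalEquivProd.tsum_eq, ENNReal.tsum_sigma']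
  refine tsum_congr fun m => ?_
  exact Finset.tsum_subtype (Finset.HasAntidiagonal.antidiagonal m) fun p => f p.1 * g p.2

/-- Geometric series in `x / m`. The form `m - 0` matches the weights of `indexSum 0`. -/
theorem ofReal_one_div_sub_mul_pow {x : ℝ} (hx0 : 0 ≤ x) (hx : x < 1) {a m : ℕ} (ha : 1 ≤ a)
    (hm : m ≠ 0) :
    ENNReal.ofReal (1 / ((m - x) * m ^ (a - 1))) =
      ∑' i : ℕ, ENNReal.ofReal x ^ i * ENNReal.ofReal (1 / ((m - 0) * m ^ (a + i - 1))) := by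
  have hm1 : (1 : ℝ) ≤ m := by exact_mod_cast Nat.one_le_iff_ne_zero.2 hm
  have hm0 : (0 : ℝ) < m := by linarith
  have hr : x / m < 1 := by rw [div_lt_one hm0]; linarith
  have hs := (hasSum_geometric_of_lt_one (div_nonneg hx0 hm0.le) hr).mul_left (1 / (m : ℝ) ^ a)
  have he : 1 / (m : ℝ) ^ a * (1 - x / m)⁻¹ = 1 / ((m - x) * m ^ (a - 1)) := by
    obtain ⟨a, rfl⟩ := Nat.exists_eq_add_of_le' ha
    have : (m : ℝ) - x ≠ 0 := by linarith
    rw [Nat.add_sub_cancel, pow_succ]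
    field_simp
  rw [← he, ← hs.tsum_eq, ENNReal.ofReal_tsum_of_nonneg (fun i => by positivity) hs.summable]
  refine tsum_congr fun i => ?_
  rw [← ENNReal.ofReal_pow hx0, ← ENNReal.ofReal_mul (by positivity)]
  congr 1
  obtain ⟨a, rfl⟩ := Nat.exists_eq_add_of_le' ha
  rw [add_right_comm, Nat.add_sub_cancel, pow_add, sub_zero, div_pow, pow_succ, pow_add]
  field_simp

theorem indexSum_eq_tsum_shiftSum {x : ℝ} (hx0 : 0 ≤ x) (hx : x < 1) {k : List ℕ}
    (hpos : ∀ a ∈ k, 1 ≤ a) (m : ℕ) :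
    indexSum x k m =
      ∑' N : ℕ, ENNReal.ofReal x ^ N * shiftSum k N fun t => indexSum 0 t m := by
  induction k generalizing m with
  | nil =>
    rw [tsum_eq_single 0 fun N hN => by simp [shiftSum, hN]]
    simp [shiftSum, indexSum]
  | cons a l ih =>
    have ih := ih fun b hb => hpos b (by simp [hb])
    simp only [shiftSum, indexSum, shiftSum_mul_left, shiftSum_sum]
    rcases eq_or_ne m 0 with rfl | hm
    · simp
    rw [ofReal_one_div_sub_mul_pow hx0 hx (hpos a (by simp)) hm]
    simp only [ih]
    rw [← Summable.tsum_finsetSum fun _ _ => ENNReal.summable]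
    simp only [← Finset.mul_sum]
    rw [ENNReal.tsum_mul_tsum_eq_tsum_sum_antidiagonal]
    refine tsum_congr fun N => ?_
    rw [Finset.mul_sum]
    refine Finset.sum_congr rfl fun p hp => ?_
    rw [← Finset.HasAntidiagonal.mem_antidiagonal.1 hp, pow_add]
    ring

/-- The generating function of the sums of nested sums over shifted indices. -/
theorem tsum_indexSum {x : ℝ} (hx0 : 0 ≤ x) (hx : x < 1) {k : List ℕ} (hpos : ∀ a ∈ k, 1 ≤ a) :
    ∑' m, indexSum x k m =
      ∑' N : ℕ, (shiftSum k N fun t => ∑' m, indexSum 0 t m) * ENNReal.ofReal x ^ N := by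
  simp only [indexSum_eq_tsum_shiftSum hx0 hx hpos]
  rw [ENNReal.tsum_comm]
  simp only [ENNReal.tsum_mul_left, tsum_shiftSum, mul_comm]

/-! ### Finiteness and comparison of coefficients -/

/-- For `m ≥ 1` and `x ≤ 1 / 2` one has `1 / (m - x) ≤ 2 / m`, so each letter costs at most a factor
`2`. This reduces finiteness of the generating function at `1 / 2` to convergence at `0`. -/
theorem wordSum_le {x : ℝ} (hx : x ≤ 1 / 2) (w : List Bool) (m : ℕ) :
    wordSum x w m ≤ 2 ^ w.length * wordSum 0 w m := by
  induction w generalizing m with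
  | nil => simp [wordSum]
  | cons b w ih =>
    cases b
    · rcases Nat.eq_zero_or_pos m with rfl | hm
      · simp [wordSum]
      have hm : (1 : ℝ) ≤ m := by exact_mod_cast hm
      have h : ENNReal.ofReal (1 / (m - x)) ≤ 2 * ENNReal.ofReal (1 / (m - 0)) := by
        rw [← ENNReal.ofReal_ofNat, ← ENNReal.ofReal_mul (by norm_num)]
        refine ENNReal.ofReal_le_ofReal ?_
        rw [sub_zero, mul_one_div, div_le_div_iff₀ (by linarith) (by linarith)]
        linarith
      calc wordSum x (false :: w) m
          ≤ 2 * ENNReal.ofReal (1 / (m - 0)) *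
            ∑ n ∈ Finset.range m, 2 ^ w.length * wordSum 0 w n :=
            mul_le_mul' h (Finset.sum_le_sum fun n _ => ih n)
        _ = _ := by
            rw [← Finset.mul_sum, wordSum, List.length_cons, pow_succ]
            ring
    · rw [wordSum, wordSum, List.length_cons, pow_succ]
      calc _ ≤ ENNReal.ofReal (1 / m) * (2 ^ w.length * wordSum 0 w m) := mul_le_mul_right (ih m) _
        _ ≤ ENNReal.ofReal (1 / m) * (2 ^ w.length * 2 * wordSum 0 w m) := by
            gcongr
            exact le_mul_of_one_le_right' one_le_two
        _ = _ := by ring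

theorem tsum_mul_pow_eq_add (C : ℕ → ℝ≥0∞) (x : ℝ) : ∑' N, C N * ENNReal.ofReal x ^ N =
    C 0 + (∑' N, C (N + 1) * ENNReal.ofReal x ^ N) * ENNReal.ofReal x := by
  rw [tsum_eq_zero_add' ENNReal.summable]
  simp only [pow_succ, ← mul_assoc]
  rw [ENNReal.tsum_mul_right]
  simp

/-- Let `x` tend to `0` from the right: beyond its constant term the series of `B` is at most `R *
x`, with `R` the finite value of the shifted series at `1 / 2`. -/
theorem coeff_zero_le_of_forall_tsum_mul_pow_le {A B : ℕ → ℝ≥0∞}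
    (hB : ∑' N, B N * ENNReal.ofReal (1 / 2) ^ N ≠ ∞)
    (h : ∀ x : ℝ, 0 < x → x ≤ 1 / 2 →
      ∑' N, A N * ENNReal.ofReal x ^ N ≤ ∑' N, B N * ENNReal.ofReal x ^ N) : A 0 ≤ B 0 := by
  set R := ∑' N, B (N + 1) * ENNReal.ofReal (1 / 2) ^ N with hR
  have hRt : R ≠ ∞ := by
    intro htop
    apply hB
    rw [tsum_mul_pow_eq_add, ← hR, htop]
    simp
  have key : ∀ x : ℝ, 0 < x → x ≤ 1 / 2 → A 0 ≤ B 0 + R * ENNReal.ofReal x := by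
    intro x hx0 hx
    calc A 0 = A 0 * ENNReal.ofReal x ^ 0 := by simp
      _ ≤ ∑' N, A N * ENNReal.ofReal x ^ N := ENNReal.le_tsum 0
      _ ≤ ∑' N, B N * ENNReal.ofReal x ^ N := h x hx0 hx
      _ = B 0 + (∑' N, B (N + 1) * ENNReal.ofReal x ^ N) * ENNReal.ofReal x :=
        tsum_mul_pow_eq_add B x
      _ ≤ _ := by
        gcongr
        exact ENNReal.tsum_le_tsum fun N => by gcongr
  have ht : Filter.Tendsto (fun x : ℝ => B 0 + R * ENNReal.ofReal x) (nhdsWithin 0 (Set.Ioi 0))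
      (nhds (B 0 + R * ENNReal.ofReal 0)) := by
    refine Filter.Tendsto.mono_left ?_ nhdsWithin_le_nhds
    exact (ENNReal.Tendsto.const_mul (ENNReal.tendsto_ofReal Filter.tendsto_id)
      (Or.inr hRt)).const_add _
  have := ge_of_tendsto ht (b := A 0) (by
    filter_upwards [Ioc_mem_nhdsGT (show (0 : ℝ) < 1 / 2 by norm_num)] with x hx
    exact key x hx.1 hx.2)
  simpa using this

theorem coeff_zero_eq_of_forall_tsum_mul_pow_eq {A B : ℕ → ℝ≥0∞}
    (hA : ∑' N, A N * ENNReal.ofReal (1 / 2) ^ N ≠ ∞)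
    (h : ∀ x : ℝ, 0 < x → x ≤ 1 / 2 →
      ∑' N, A N * ENNReal.ofReal x ^ N = ∑' N, B N * ENNReal.ofReal x ^ N) : A 0 = B 0 :=
  le_antisymm
    (coeff_zero_le_of_forall_tsum_mul_pow_le (h (1 / 2) (by norm_num) le_rfl ▸ hA) fun x hx0 hx =>
      (h x hx0 hx).le)
    (coeff_zero_le_of_forall_tsum_mul_pow_le hA fun x hx0 hx => (h x hx0 hx).ge)

/-- Uniqueness of the coefficients of a power series with nonnegative coefficients. -/
theorem eq_of_forall_tsum_mul_pow_eq {A B : ℕ → ℝ≥0∞}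
    (hA : ∑' N, A N * ENNReal.ofReal (1 / 2) ^ N ≠ ∞)
    (h : ∀ x : ℝ, 0 < x → x ≤ 1 / 2 →
      ∑' N, A N * ENNReal.ofReal x ^ N = ∑' N, B N * ENNReal.ofReal x ^ N) (N : ℕ) :
    A N = B N := by
  have h0 := coeff_zero_eq_of_forall_tsum_mul_pow_eq hA h
  induction N generalizing A B with
  | zero => exact h0
  | succ N ih =>
    have hA0 : A 0 ≠ ∞ := by
      intro htop
      rw [tsum_mul_pow_eq_add, htop] at hA
      simp at hA
    have hA1 : ∑' N, A (N + 1) * ENNReal.ofReal (1 / 2) ^ N ≠ ∞ := by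
      intro htop
      apply hA
      rw [tsum_mul_pow_eq_add, htop]
      simp
    -- Cancel the equal finite constant terms and divide by `x > 0`, so that the induction applies
    -- to the shifted coefficients.
    have h1 : ∀ x : ℝ, 0 < x → x ≤ 1 / 2 → ∑' N, A (N + 1) * ENNReal.ofReal x ^ N =
        ∑' N, B (N + 1) * ENNReal.ofReal x ^ N := by
      intro x hx0 hx
      have := h x hx0 hx
      rw [tsum_mul_pow_eq_add A, tsum_mul_pow_eq_add B, ← h0, ENNReal.add_right_inj hA0] at this
      exact (ENNReal.mul_left_inj (ENNReal.ofReal_pos.2 hx0).ne' ENNReal.ofReal_ne_top).1 this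
    exact ih (A := fun N => A (N + 1)) (B := fun N => B (N + 1)) hA1 h1
      (coeff_zero_eq_of_forall_tsum_mul_pow_eq hA1 h1)

/-! ### Zeta values as nested sums -/

/-- A sum over tuples whose entries are bounded, decreasing and positive is a nested sum. -/
theorem tsum_strictAnti_eq (k : List ℕ) (hpos : ∀ a ∈ k, 1 ≤ a) (N : ℕ∞) (hN : N ≠ 0) :
    (∑' n : Fin k.length → ℕ,
      open Classical in if (StrictAnti n ∧ ∀ i, 1 ≤ n i) ∧ ∀ i, (n i : ℕ∞) < N then
        ENNReal.ofReal (∏ i, 1 / (n i : ℝ) ^ k.get i) else 0) =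
      ∑' m : ℕ, open Classical in if (m : ℕ∞) < N then indexSum 0 k m else 0 := by
  classical
  -- The bound must vary: once the first entry `m` is fixed, the remaining entries are bounded by
  -- `m`. Starting from `N = ⊤` recovers the unrestricted sum.
  induction k generalizing N with
  | nil =>
    have : Subsingleton (Fin ([] : List ℕ).length → ℕ) :=
      inferInstanceAs (Subsingleton (Fin 0 → ℕ))
    have h0 : StrictAnti fun i : Fin ([] : List ℕ).length => (i.elim0 : ℕ) := fun i => i.elim0
    refine (tsum_eq_single (fun i : Fin 0 => i.elim0)
      fun n hn => absurd (Subsingleton.elim _ _) hn).trans ?_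
    rw [tsum_eq_single 0 fun m hm => by simp [indexSum, hm],
      if_pos ⟨⟨h0, fun i => i.elim0⟩, fun i => i.elim0⟩,
      if_pos (by simpa [pos_iff_ne_zero] using hN)]
    simp [indexSum]
  | cons a l ih =>
    have ih := ih fun b hb => hpos b (by simp [hb])
    refine ((Fin.consEquiv (fun _ : Fin (l.length + 1) => ℕ)).tsum_eq _).symm.trans ?_
    rw [ENNReal.tsum_prod']
    refine tsum_congr fun m => ?_
    by_cases hmN : (m : ℕ∞) < N
    swap
    · rw [if_neg hmN]
      exact ENNReal.tsum_eq_zero.2 fun n => if_neg fun h => hmN (h.2 (0 : Fin (l.length + 1)))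
    rw [if_pos hmN]
    rcases Nat.eq_zero_or_pos m with rfl | hm
    · simp only [indexSum, Finset.range_zero, Finset.sum_empty, mul_zero]
      exact ENNReal.tsum_eq_zero.2 fun n => if_neg fun h =>
        absurd (h.1.2 (0 : Fin (l.length + 1))) (by simp [Fin.consEquiv])
    have hsum : ∑ n ∈ Finset.range m, indexSum 0 l n =
        ∑' n : ℕ, if (n : ℕ∞) < (m : ℕ∞) then indexSum 0 l n else 0 := by
      rw [tsum_eq_sum (s := Finset.range m) fun n hn => by
        rw [if_neg]; simpa using hn]
      exact Finset.sum_congr rfl fun n hn => by rw [if_pos]; simpa using hn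
    have hw : ((m : ℝ) - 0) * m ^ (a - 1) = m ^ a := by
      rw [sub_zero, ← pow_succ', Nat.sub_add_cancel (hpos a (by simp))]
    rw [indexSum, hw, hsum, ← ih m (by exact_mod_cast hm.ne'), ← ENNReal.tsum_mul_left]
    refine tsum_congr fun n => ?_
    rw [mul_ite, mul_zero]
    refine if_congr ?_ ?_ rfl
    · change (StrictAnti (Fin.cons m n : Fin (l.length + 1) → ℕ) ∧
        ∀ i, 1 ≤ (Fin.cons m n : Fin (l.length + 1) → ℕ) i) ∧
        (∀ i, ((Fin.cons m n : Fin (l.length + 1) → ℕ) i : ℕ∞) < N) ↔ _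
      simp only [Fin.forall_fin_succ, Fin.cons_zero, Fin.cons_succ, Nat.cast_lt]
      constructor
      · rintro ⟨⟨hn, -, h1⟩, -⟩
        exact ⟨⟨fun i j hij => by simpa using hn (Fin.succ_lt_succ_iff.2 hij), h1⟩,
          fun i => by simpa using hn (Fin.succ_pos i)⟩
      · rintro ⟨⟨hn, h1⟩, hlt⟩
        refine ⟨⟨?_, hm, h1⟩, hmN, fun i => lt_trans (by exact_mod_cast hlt i) hmN⟩
        intro i j hij
        induction j using Fin.cases with
        | zero => exact absurd hij (Fin.not_lt_zero i)
        | succ j =>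
          induction i using Fin.cases with
          | zero => simpa using hlt j
          | succ i => simpa using hn (Fin.succ_lt_succ_iff.1 hij)
    · rw [← ENNReal.ofReal_mul (by positivity)]
      congr 1
      exact Fin.prod_univ_succ fun i : Fin (l.length + 1) =>
        1 / ((Fin.cons m n : Fin (l.length + 1) → ℕ) i : ℝ) ^ (a :: l).get i

theorem mzv_nonneg (k : List ℕ) : 0 ≤ mzv k :=
  tsum_nonneg fun _ => Finset.prod_nonneg fun _ _ => by positivity

theorem ofReal_mzv {k : List ℕ} (hpos : ∀ a ∈ k, 1 ≤ a) (h2 : ∀ a ∈ k.head?, 2 ≤ a) :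
    ENNReal.ofReal (mzv k) = ∑' m, indexSum 0 k m := by
  classical
  have h := tsum_strictAnti_eq k hpos ⊤ (by simp)
  simp only [ENat.natCast_lt_top, implies_true, and_true, if_true] at h
  rw [← h, mzv, ENNReal.ofReal_tsum_of_nonneg
    (fun n => Finset.prod_nonneg fun _ _ => by positivity) (mzv_summable k hpos h2)]
  exact (tsum_subtype {n : Fin k.length → ℕ | StrictAnti n ∧ ∀ i, 1 ≤ n i}
    fun n => ENNReal.ofReal (∏ i, 1 / (n i : ℝ) ^ k.get i)).trans
    (tsum_congr fun n => by simp [Set.indicator_apply])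

theorem head?_modifyHead_succ {k : List ℕ} (hpos : ∀ a ∈ k, 1 ≤ a) :
    ∀ a ∈ (k.modifyHead (· + 1)).head?, 2 ≤ a := by
  cases k with
  | nil => simp
  | cons b l =>
    have := hpos b (by simp)
    simp only [List.modifyHead_cons, List.head?_cons, Option.mem_def, Option.some.injEq,
      forall_eq']
    omega

theorem modifyHead_succ_pos {k : List ℕ} (hpos : ∀ a ∈ k, 1 ≤ a) :
    ∀ a ∈ k.modifyHead (· + 1), 1 ≤ a := by
  cases k with
  | nil => simp
  | cons b l =>
    simp only [List.modifyHead_cons, List.mem_cons, forall_eq_or_imp]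
    exact ⟨by omega, fun a ha => hpos a (by simp [ha])⟩

/-! ### Ohno's relation and the conclusion -/

/-- Ohno's relation, in terms of Hoffman's dual. -/
theorem shiftSum_indexSum_hoffmanDual {k : List ℕ} (hne : k ≠ []) (hpos : ∀ a ∈ k, 1 ≤ a)
    (N : ℕ) :
    (shiftSum (k.modifyHead (· + 1)) N fun t => ∑' m, indexSum 0 t m) =
      shiftSum ((hoffmanDual k).reverse.modifyHead (· + 1)) N fun t => ∑' m, indexSum 0 t m := by
  have hne' := hoffmanDual_ne_nil hne hpos
  have hpos' := hoffmanDual_pos hpos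
  have hposr : ∀ a ∈ (hoffmanDual k).reverse, 1 ≤ a := fun a ha => hpos' a (by simpa using ha)
  have hner : (hoffmanDual k).reverse ≠ [] := by simpa using hne'
  obtain ⟨w, hw, -⟩ := exists_indexWord_reverse hne
  obtain ⟨v, hv, hvr⟩ := exists_indexWord_reverse hne'
  have hvw : v = w.map (!·) :=
    List.append_cancel_right (hv.symm.trans (indexWord_hoffmanDual hne hpos hw))
  refine eq_of_forall_tsum_mul_pow_eq
    (A := fun N => shiftSum (k.modifyHead (· + 1)) N fun t => ∑' m, indexSum 0 t m)
    (B := fun N => shiftSum ((hoffmanDual k).reverse.modifyHead (· + 1)) N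
      fun t => ∑' m, indexSum 0 t m) ?_ ?_ N
  -- At `x = 1 / 2` the generating function is dominated by a constant multiple of a convergent zeta
  -- value.
  · rw [← tsum_indexSum (by norm_num) (by norm_num) (modifyHead_succ_pos hpos)]
    rw [← wordSum_indexWord]
    refine ne_top_of_le_ne_top ?_ (ENNReal.tsum_le_tsum (wordSum_le le_rfl _))
    rw [ENNReal.tsum_mul_left, wordSum_indexWord,
      ← ofReal_mzv (modifyHead_succ_pos hpos) (head?_modifyHead_succ hpos)]
    exact ENNReal.mul_ne_top (by simp) ENNReal.ofReal_ne_top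
  · intro x hx0 hx
    have hx1 : x < 1 := by linarith
    rw [← tsum_indexSum hx0.le hx1 (modifyHead_succ_pos hpos),
      ← tsum_indexSum hx0.le hx1 (modifyHead_succ_pos hposr), ← wordSum_indexWord,
      ← wordSum_indexWord, indexWord_modifyHead hne hpos, indexWord_modifyHead hner hposr, hw, hvr,
      hvw, tsum_wordSum_dual hx0.le hx1]

/-- Duality: the index `(1, l)^∨` is dual to the reversed index `l` with raised first entry. -/
theorem mzv_hoffmanDual_one_cons {l : List ℕ} (hne : l ≠ []) (hpos : ∀ a ∈ l, 1 ≤ a) :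
    ENNReal.ofReal (mzv (hoffmanDual (1 :: l))) =
      ∑' m, indexSum 0 (l.reverse.modifyHead (· + 1)) m := by
  have hpos1 : ∀ a ∈ 1 :: l, 1 ≤ a := by simpa using hpos
  have hposr : ∀ a ∈ l.reverse, 1 ≤ a := fun a ha => hpos a (by simpa using ha)
  have hner : l.reverse ≠ [] := by simpa using hne
  obtain ⟨w, hw, hwr⟩ := exists_indexWord_reverse hne
  -- The prepended entry `1` contributes a leading `false`, which Hoffman's dual flips to `true`;
  -- this also makes the resulting index admissible.
  have hd : indexWord (hoffmanDual (1 :: l)) = true :: (w.map (!·) ++ [false]) :=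
    indexWord_hoffmanDual (by simp) hpos1 (w := false :: w) (by simp [indexWord, hw])
  have hhead : ∀ a ∈ (hoffmanDual (1 :: l)).head?, 2 ≤ a := by
    rcases h : hoffmanDual (1 :: l) with _ | ⟨b, t⟩
    · simp
    · intro a ha
      obtain rfl : b = a := by simpa using ha
      rw [h, indexWord] at hd
      by_contra hlt
      rw [show b - 1 = 0 by omega] at hd
      simp at hd
  rw [ofReal_mzv (hoffmanDual_pos hpos1) hhead, ← wordSum_indexWord, ← wordSum_indexWord, hd,
    indexWord_modifyHead hner hposr, hwr, tsum_wordSum_dual le_rfl one_pos]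
  simp [Function.comp_def]

theorem theorem2p2 (k : List ℕ) (hne : k ≠ []) (hpos : ∀ a ∈ k, 1 ≤ a) (m : ℕ) :
    ∑ e ∈ Finset.Nat.antidiagonalTuple k.length m,
        mzv ((addTuple k e).modifyHead (· + 1)) =
      ∑ e ∈ Finset.Nat.antidiagonalTuple (hoffmanDual k).length m,
        mzv (hoffmanDual (1 :: addTuple (hoffmanDual k) e)) := by
  have hne' := hoffmanDual_ne_nil hne hpos
  -- Both sides are nonnegative, so the identity may be checked in `ℝ≥0∞`. Reversing the summation
  -- index on the right is harmless because the sum runs over all shifts.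
  rw [← ENNReal.ofReal_eq_ofReal_iff (Finset.sum_nonneg fun _ _ => mzv_nonneg _)
    (Finset.sum_nonneg fun _ _ => mzv_nonneg _),
    ENNReal.ofReal_sum_of_nonneg fun _ _ => mzv_nonneg _,
    ENNReal.ofReal_sum_of_nonneg fun _ _ => mzv_nonneg _,
    sum_addTuple k m fun t => ENNReal.ofReal (mzv (t.modifyHead (· + 1))),
    sum_addTuple (hoffmanDual k) m fun t => ENNReal.ofReal (mzv (hoffmanDual (1 :: t))),
    shiftSum_congr hpos m (Ψ := fun t => ∑' n, indexSum 0 (t.modifyHead (· + 1)) n)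
      fun l _ hl => ofReal_mzv (modifyHead_succ_pos hl) (head?_modifyHead_succ hl),
    shiftSum_congr (hoffmanDual_pos hpos) m
      (Ψ := fun t => ∑' n, indexSum 0 (t.reverse.modifyHead (· + 1)) n)
      fun l hlen hl => mzv_hoffmanDual_one_cons
        (fun h => hne' (List.length_eq_zero_iff.1 (by rw [← hlen, h]; rfl))) hl,
    shiftSum_modifyHead hne m fun t => ∑' n, indexSum 0 t n,
    shiftSum_reverse (hoffmanDual k) m fun t => ∑' n, indexSum 0 (t.modifyHead (· + 1)) n,
    shiftSum_modifyHead (by simpa using hne') m fun t => ∑' n, indexSum 0 t n]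
  exact shiftSum_indexSum_hoffmanDual hne hpos m
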